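/- Let $\mathscr{A}$ be a (locally small) category that is cocomplete, wellpowered and cowellpowered, equipped with a faithful functor $U\colon\mathscr{A}\to\mathsf{Set}$ such that (a) $U$ preserves intersections (i.e. multiple pullbacks of monomorphisms); (b) $U$ is fibre-small: for every set $X$ there is, up to isomorphism, only a set of objects $A$ with $UA=X$; (c) $U$ is uniquely transportable: for every object $A$ and every bijection $b\colon UA\to X$ there is a unique object $\bar A$ with $U\bar A=X$ for which $b$ carries an isomorphism $A\cong\bar A$. Let $H\colon\mathscr{A}\to\mathscr{A}$ be an endofunctor preserving intersections. A coalgebra is a morphism $a\colon A\to HA$; a pointed coalgebra $(A,a,x)$ is a coalgebra $(A,a)$ with an element $x\in UA$, and morphisms of pointed coalgebras are the coalgebra homomorphisms $f$ for which $Uf$ preserves the points. Quotients of a (pointed) coalgebra are the morphisms from it carried by strong epimorphisms of $\mathscr{A}$, and subobjects (subcoalgebras) are the morphisms into it carried by monomorphisms of $\mathscr{A}$; they are proper if they are not invertible. A coalgebra is simple if it has no proper quotient, and a pointed coalgebra is well-pointed if it has no proper quotient and no proper subobject. The well-pointed modification $\mathrm{wp}(A,a,x)$ of a pointed coalgebra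 is obtained by forming the simple quotient $e\colon(A,a)\to(\bar A,\bar a)$ and then the least subcoalgebra of $(\bar A,\bar a)$ containing the point $Ue(x)$, pointed by $Ue(x)$. Theorem. $H$ has a final coalgebra if and only if $H$ has, up to isomorphism, only a set of well-pointed coalgebras. Moreover, let $T$ be a set of representatives of the well-pointed coalgebras up to isomorphism of pointed coalgebras (one from each isomorphism class). Then $\mathrm{wp}(A,a,x)$ exists and is unique up to isomorphism for every pointed coalgebra $(A,a,x)$, and it is isomorphic to precisely one member of $T$, so that every coalgebra $(A,a)$ determines a function $a^+\colon UA\to T$, $a^+(x)\cong\mathrm{wp}(A,a,x)$. The set $T$ carries the final coalgebra: there is a final coalgebra $\bar\tau\colon\bar T\to H\bar T$ with $U\bar T=T$ such that, for every coalgebra $(A,a)$, the function $a^+$ is carried by the unique coalgebra homomorphism $(A,a)\to(\bar T,\bar\tau)$. -/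

import Mathlib

universe v v' u u'

open CategoryTheory CategoryTheory.Limits CategoryTheory.Endofunctor

namespace WellPointed

/-- A functor preserves (wide) intersections if it preserves all limits of small families of
monomorphisms with a common codomain (multiple pullbacks of monomorphisms). -/
def PreservesIntersections {C : Type u} [Category.{v} C] {D : Type u'} [Category.{v'} D]
    (F : C ⥤ D) : Prop :=
  ∀ (J : Type v) (B : C) (X : J → C) (m : ∀ j, X j ⟶ B), (∀ j, Mono (m j)) →
    PreservesLimit (WidePullbackShape.wideCospan B X m) F

/-- For every set `X` there is, up to isomorphism, only a set of objects with underlying set `X`. -/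
def FibreSmall {C : Type u} [Category.{v} C] (U : C ⥤ Type v) : Prop :=
  ∀ X : Type v, ObjectProperty.EssentiallySmall.{v} (fun A : C => U.obj A = X)

/-- For every object `A` and every bijection `b : U A → X` there is a unique object `B` with
`U B = X` for which `b` carries an isomorphism from `A` to `B`. -/
def UniquelyTransportable {C : Type u} [Category.{v} C] (U : C ⥤ Type v) : Prop :=
  ∀ (A : C) (X : Type v) (b : U.obj A ≃ X),
    ∃! B : C, ∃ (h : U.obj B = X) (i : A ≅ B), ∀ x : U.obj A, cast h (U.map i.hom x) = b x

section Coalg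

variable {C : Type u} [Category.{v} C]

/-- A coalgebra is simple if every homomorphism from it carried by a strong epimorphism of the
base category is invertible. -/
def IsSimple {H : C ⥤ C} (A : Coalgebra H) : Prop :=
  ∀ (B : Coalgebra H) (q : A ⟶ B), StrongEpi q.f → IsIso q

variable (H : C ⥤ C) (U : C ⥤ Type v)

/-- The category of pointed coalgebras `(A, a, x)`, with `x ∈ U A`: the category of elements of
the underlying set functor of coalgebras.  Morphisms are the coalgebra homomorphisms preserving
the point. -/
abbrev PointedCoalgebra : Type _ := (Coalgebra.forget H ⋙ U).Elements

variable {H U}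

/-- The pointed coalgebra `(A, a, x)`. -/
abbrev PointedCoalgebra.mk (A : Coalgebra H) (x : U.obj A.V) : PointedCoalgebra H U :=
  Functor.elementsMk (Coalgebra.forget H ⋙ U) A x

/-- The morphism of the base category which carries a morphism of pointed coalgebras. -/
abbrev PointedCoalgebra.carrier {P Q : PointedCoalgebra H U} (f : P ⟶ Q) : P.1.V ⟶ Q.1.V :=
  f.1.f

/-- A pointed coalgebra is well-pointed if it has no proper quotient (a morphism from it carried by
a strong epimorphism) and no proper subobject (a morphism into it carried by a monomorphism). -/
def IsWellPointed (P : PointedCoalgebra H U) : Prop :=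
  (∀ (Q : PointedCoalgebra H U) (q : P ⟶ Q),
      StrongEpi (PointedCoalgebra.carrier q) → IsIso q) ∧
    ∀ (Q : PointedCoalgebra H U) (m : Q ⟶ P), Mono (PointedCoalgebra.carrier m) → IsIso m

/-- `m : Q ⟶ S` is the least subcoalgebra of (the coalgebra of) `S` which contains the point
of `S`. -/
def IsLeastSubcoalgebra {Q S : PointedCoalgebra H U} (m : Q ⟶ S) : Prop :=
  Mono (PointedCoalgebra.carrier m) ∧
    ∀ (Q' : PointedCoalgebra H U) (m' : Q' ⟶ S), Mono (PointedCoalgebra.carrier m') →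
      ∃ k : Q ⟶ Q', k ≫ m' = m

/-- `e : P ⟶ S` is the simple quotient of the coalgebra of `P`, pointed by the image of the point
of `P`. -/
def IsSimpleQuotient {P S : PointedCoalgebra H U} (e : P ⟶ S) : Prop :=
  StrongEpi (PointedCoalgebra.carrier e) ∧ IsSimple S.1

/-- `Q` is (up to isomorphism) the well-pointed modification `wp(A, a, x)` of `P = (A, a, x)`: form
the simple quotient of `P`, pointed by the image of `x`, and then the least subcoalgebra of it
which contains that point. -/
def IsWellPointedModification (P Q : PointedCoalgebra H U) : Prop :=
  ∃ (S : PointedCoalgebra H U) (e : P ⟶ S) (m : Q ⟶ S),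
    IsSimpleQuotient e ∧ IsLeastSubcoalgebra m

/-- The family `rep`, indexed by the set `T`, represents the well-pointed coalgebras: its members
are well-pointed, and every well-pointed coalgebra is isomorphic to precisely one of them. -/
def RepresentsWellPointed {T : Type v} (rep : T → PointedCoalgebra H U) : Prop :=
  (∀ t, IsWellPointed (rep t)) ∧
    ∀ P : PointedCoalgebra H U, IsWellPointed P → ∃! t, Nonempty (P ≅ rep t)

end Coalg

end WellPointed

open WellPointed

/-! Parallel homomorphisms into a simple coalgebra agree, since their coequalizer is a quotient
(`IsSimple.eq_of_hom`); so a simple, weakly terminal coalgebra is final. If only a set of simple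
coalgebras exists, the simple quotient of their coproduct is such a coalgebra, because every
coalgebra maps to its own simple quotient.

Let `T` represent the well-pointed coalgebras. In a simple coalgebra `A`, each point generates a
least subcoalgebra, which is well-pointed; the resulting map from points of `A` to `T` is injective
by uniqueness of homomorphisms into `A`. Hence underlying sets of simple coalgebras embed in `T`,
and transport with fibre-smallness leaves only a set of them. For the final coalgebra the injection
is also onto. Conversely, homomorphisms out of simple coalgebras are monic, so well-pointed
coalgebras are subobjects of a final one, equipped with a structure and a point. -/

namespace WellPointed

/-! ### Factorizations and intersections in the base category -/

section Base

variable {C : Type u} [Category.{v} C]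

/-- Small families of strong epimorphisms with a common domain have a cointersection, which is
again a strong epimorphism. -/
theorem exists_cointersection [HasColimits C] {A : C} {ι : Type v} (X : ι → C)
    (e : ∀ i, A ⟶ X i) [∀ i, StrongEpi (e i)] :
    ∃ (W : C) (w : A ⟶ W) (k : ∀ i, X i ⟶ W), StrongEpi w ∧ (∀ i, e i ≫ k i = w) ∧
      ∀ (Z : C) (z : A ⟶ Z) (l : ∀ i, X i ⟶ Z), (∀ i, e i ≫ l i = z) →
        ∃ r : W ⟶ Z, w ≫ r = z := by
  have hext : ∀ {Z : C} (g h : widePushout A X e ⟶ Z),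
      WidePushout.head e ≫ g = WidePushout.head e ≫ h → g = h := by
    intro Z g h hgh
    refine WidePushout.hom_ext _ _ _ (fun i => ?_) hgh
    rw [← cancel_epi (e i), ← Category.assoc, ← Category.assoc, WidePushout.arrow_ι]
    exact hgh
  refine ⟨widePushout A X e, WidePushout.head e, WidePushout.ι e, ⟨⟨fun g h => hext g h⟩, ?_⟩,
    fun i => WidePushout.arrow_ι e i, fun Z z l hl => ⟨WidePushout.desc z l hl,
      WidePushout.head_desc _ _ _ _⟩⟩
  intro P Q z _
  refine ⟨fun {f g} sq => ?_⟩
  have key : ∀ i, CommSq f (e i) z (WidePushout.ι e i ≫ g) := fun i => ⟨by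
    rw [sq.w, ← Category.assoc, WidePushout.arrow_ι]⟩
  refine CommSq.HasLift.mk' ⟨WidePushout.desc f (fun i => (key i).lift) fun i => (key i).fac_left,
    WidePushout.head_desc _ _ _ _, ?_⟩
  apply hext
  rw [← sq.w, ← Category.assoc, WidePushout.head_desc]

/-- A morphism is equal, as a quotient of its domain, to a member of a small family. -/
theorem exists_small_quotients [WellPowered.{v} Cᵒᵖ] (A : C) (p : ∀ ⦃B : C⦄, (A ⟶ B) → Prop) :
    ∃ (ι : Type v) (X : ι → C) (e : ∀ i, A ⟶ X i), (∀ i, p (e i)) ∧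
      ∀ ⦃B : C⦄ (q : A ⟶ B) [Epi q], p q → ∃ (i : ι) (j : X i ≅ B), e i ≫ j.hom = q := by
  have := small_subobject.{v} _ (Opposite.op A)
  let S := {s : Subobject (Opposite.op A) // ∃ (B : C) (q : A ⟶ B) (_ : Epi q),
    p q ∧ Subobject.mk q.op = s}
  have : Small.{v} S := inferInstance
  choose B q hq hp hs using fun s : S => s.2
  refine ⟨Shrink.{v} S, fun i => B ((equivShrink S).symm i), fun i => q ((equivShrink S).symm i),
    fun i => hp _, fun B' q' _ hq' => ?_⟩
  let s : S := ⟨Subobject.mk q'.op, B', q', inferInstance, hq', rfl⟩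
  have h : Subobject.mk (q s).op = Subobject.mk q'.op := hs s
  refine ⟨equivShrink S s, ?_⟩
  beta_reduce
  rw [Equiv.symm_apply_apply]
  refine ⟨(Subobject.isoOfMkEqMk _ _ h).unop.symm, ?_⟩
  apply Quiver.Hom.op_inj
  simp [Subobject.isoOfMkEqMk]

/-- A monomorphism is equal, as a subobject of its codomain, to a member of a small family. -/
theorem exists_small_subobjects [WellPowered.{v} C] (A : C) (p : ∀ ⦃B : C⦄, (B ⟶ A) → Prop) :
    ∃ (ι : Type v) (X : ι → C) (e : ∀ i, X i ⟶ A), (∀ i, p (e i) ∧ Mono (e i)) ∧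
      ∀ ⦃B : C⦄ (q : B ⟶ A) [Mono q], p q → ∃ (i : ι) (j : B ≅ X i), j.hom ≫ e i = q := by
  have := small_subobject.{v} C A
  let S := {s : Subobject A // ∃ (B : C) (q : B ⟶ A) (_ : Mono q),
    p q ∧ Subobject.mk q = s}
  have : Small.{v} S := inferInstance
  choose B q hq hp hs using fun s : S => s.2
  refine ⟨Shrink.{v} S, fun i => B ((equivShrink S).symm i), fun i => q ((equivShrink S).symm i),
    fun i => ⟨hp _, hq _⟩, fun B' q' _ hq' => ?_⟩
  let s : S := ⟨Subobject.mk q', B', q', inferInstance, hq', rfl⟩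
  have h : Subobject.mk (q s) = Subobject.mk q' := hs s
  refine ⟨equivShrink S s, ?_⟩
  beta_reduce
  rw [Equiv.symm_apply_apply]
  exact ⟨Subobject.isoOfMkEqMk _ _ h.symm, by simp [Subobject.isoOfMkEqMk]⟩

theorem strongEpi_of_isCoequalizer {A B Q : C} {f g : A ⟶ B} {c : B ⟶ Q} (w : f ≫ c = g ≫ c)
    (h : IsColimit (Cofork.ofπ c w)) : StrongEpi c := by
  have : Epi c := ⟨fun a b hab => Cofork.IsColimit.hom_ext h hab⟩
  refine StrongEpi.mk' fun X Y z _ u v' sq => ?_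
  have hu : f ≫ u = g ≫ u := by
    rw [← cancel_mono z, Category.assoc, Category.assoc, sq.w, reassoc_of% w]
  refine CommSq.HasLift.mk' ⟨Cofork.IsColimit.desc h u hu, Cofork.IsColimit.π_desc' h u hu, ?_⟩
  have h1 : c ≫ Cofork.IsColimit.desc h u hu = u := Cofork.IsColimit.π_desc' h u hu
  rw [← cancel_epi c, reassoc_of% h1, sq.w]

section

variable [HasColimits C] [WellPowered.{v} Cᵒᵖ]

/-- Every morphism is a strong epimorphism followed by a monomorphism. -/
theorem exists_strongEpi_mono_factorization {A B : C} (f : A ⟶ B) :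
    ∃ (I : C) (e : A ⟶ I) (m : I ⟶ B), StrongEpi e ∧ Mono m ∧ e ≫ m = f := by
  -- The image is the cointersection of all strong quotients through which `f` factors.
  obtain ⟨ι, X, e, he, hX⟩ := exists_small_quotients A
    (fun X (e : A ⟶ X) => StrongEpi e ∧ ∃ m, e ≫ m = f)
  choose l hl using fun i => (he i).2
  have : ∀ i, StrongEpi (e i) := fun i => (he i).1
  obtain ⟨W, w, k, hw, hk, hW⟩ := exists_cointersection X e
  obtain ⟨m, hm⟩ := hW B f l hl
  refine ⟨W, w, m, hw, ⟨fun {Z} g h hgh => ?_⟩, hm⟩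
  -- The coequalizer yields a further quotient in the family, so it is split by a map back to `W`;
  -- this forces `g = h`.
  have hc : StrongEpi (coequalizer.π g h) :=
    strongEpi_of_isCoequalizer (coequalizer.condition g h) (coequalizerIsCoequalizer g h)
  obtain ⟨i, j, hj⟩ := hX (w ≫ coequalizer.π g h) ⟨inferInstance, coequalizer.desc m hgh, by
    rw [Category.assoc, coequalizer.π_desc, hm]⟩
  have : coequalizer.π g h ≫ j.inv ≫ k i = 𝟙 W := by
    rw [← cancel_epi w, ← Category.assoc, ← hj]
    simp [hk]
  rw [← Category.comp_id g, ← Category.comp_id h, ← this,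
    coequalizer.condition_assoc]

/-- Intersections: small families of monomorphisms have wide pullbacks. -/
theorem exists_intersection [WellPowered.{v} C] {B : C} {ι : Type v} (X : ι → C)
    (m : ∀ i, X i ⟶ B) [∀ i, Mono (m i)] :
    ∃ (W : C) (w : W ⟶ B) (k : ∀ i, W ⟶ X i), Mono w ∧ (∀ i, k i ≫ m i = w) ∧
      ∀ (Z : C) (z : Z ⟶ B) (l : ∀ i, Z ⟶ X i), (∀ i, l i ≫ m i = z) →
        ∃ r : Z ⟶ W, r ≫ w = z := by
  -- The intersection is built from colimits: it is the image of the coproduct of all subobjects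
  -- below every `m i`.
  obtain ⟨κ, Y, n, hn, hY⟩ := exists_small_subobjects B
    (fun Y (n : Y ⟶ B) => ∀ i, ∃ l, l ≫ m i = n)
  choose l hl using fun j => (hn j).1
  obtain ⟨W, e, w, he, hw, hew⟩ := exists_strongEpi_mono_factorization (Sigma.desc n)
  have sq : ∀ i, CommSq (Sigma.desc fun j => l j i) e (m i) w := fun i => ⟨by
    rw [hew]
    refine Sigma.hom_ext _ _ fun j => ?_
    simp [hl]⟩
  refine ⟨W, w, fun i => (sq i).lift, hw, fun i => (sq i).fac_right, fun Z z t ht => ?_⟩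
  obtain ⟨I, p, q, hp, hq, hpq⟩ := exists_strongEpi_mono_factorization z
  have sq' : ∀ i, CommSq (t i) p (m i) q := fun i => ⟨by rw [ht, hpq]⟩
  obtain ⟨i, j, hj⟩ := hY q fun i => ⟨(sq' i).lift, (sq' i).fac_right⟩
  refine ⟨p ≫ j.hom ≫ Sigma.ι Y i ≫ e, ?_⟩
  simp [hew, hj, hpq]

end

/-- Maps into the image of an intersection under a functor which preserves intersections. -/
theorem PreservesIntersections.exists_lift {D : Type u'} [Category.{v'} D] {F : C ⥤ D}
    (hF : PreservesIntersections F) {B W : C} {ι : Type v} (X : ι → C)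
    (m : ∀ i, X i ⟶ B) (hm : ∀ i, Mono (m i)) (w : W ⟶ B) [Mono w] (k : ∀ i, W ⟶ X i)
    (hk : ∀ i, k i ≫ m i = w)
    (hW : ∀ (Z : C) (z : Z ⟶ B) (l : ∀ i, Z ⟶ X i), (∀ i, l i ≫ m i = z) →
        ∃ r : Z ⟶ W, r ≫ w = z)
    {Z : D} (z : Z ⟶ F.obj B) (l : ∀ i, Z ⟶ F.obj (X i)) (hl : ∀ i, l i ≫ F.map (m i) = z) :
    ∃ r : Z ⟶ F.obj W, r ≫ F.map w = z ∧ ∀ i, r ≫ F.map (k i) = l i := by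
  let s : WidePullbackCone m := WidePullbackCone.mk w k hk
  choose r hr using fun t : WidePullbackCone m => hW t.pt t.base t.π t.condition
  have hs : IsLimit s := WidePullbackCone.IsLimit.mk s r hr
    (fun t i => by
      have := hm i
      rw [← cancel_mono (m i), t.condition, ← hr t, ← hk i]
      exact Category.assoc _ _ _)
    (fun t n hn _ => by
      exact (cancel_mono w).1 (hn.trans (hr t).symm))
  have := hF ι B X m hm
  have hs' := isLimitOfPreserves F hs
  let c : Cone (WidePullbackShape.wideCospan B X m ⋙ F) :=
    WidePullbackShape.mkCone (F := WidePullbackShape.wideCospan B X m ⋙ F) z l hl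
  exact ⟨hs'.lift c, hs'.fac c none, fun i => hs'.fac c (some i)⟩

/-- The intersection of `m` with itself is `m`, with identity projections. Lifting the pair `g`, `h`
gives one map equal to both. -/
theorem PreservesIntersections.map_mono {D : Type u'} [Category.{v'} D] {F : C ⥤ D}
    (hF : PreservesIntersections F) {A B : C} (m : A ⟶ B) [Mono m] : Mono (F.map m) := by
  refine ⟨fun {Z} g h hgh => ?_⟩
  obtain ⟨r, -, hr⟩ := hF.exists_lift (ι := ULift Bool) (fun _ => A) (fun _ => m)
    (fun _ => inferInstance) m (fun _ => 𝟙 A) (fun _ => Category.id_comp m)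
    (fun Z z l hl => ⟨l ⟨true⟩, hl _⟩) (g ≫ F.map m) (fun b => if b.down then g else h)
    (fun b => by split_ifs <;> simp [hgh])
  have h1 := hr ⟨true⟩
  have h2 := hr ⟨false⟩
  simp only [↓reduceIte, Bool.false_eq_true] at h1 h2
  rw [← h1, h2]

end Base

/-! ### Simple coalgebras and simple quotients -/

section Coalgebras

variable {C : Type u} [Category.{v} C] {H : C ⥤ C}

/-- A morphism out of the codomain of an epic homomorphism is a homomorphism if the composite is. -/
def homOfEpi {A B D : Coalgebra H} (e : A ⟶ B) [Epi e.f] (f : A ⟶ D) (g : B.V ⟶ D.V)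
    (w : e.f ≫ g = f.f) : B ⟶ D where
  f := g
  h := by
    rw [← cancel_epi e.f, ← Coalgebra.Hom.h_assoc, ← H.map_comp, w, f.h, reassoc_of% w]

/-- A morphism into the domain of a monic homomorphism is a homomorphism if the composite is. -/
def homOfMono {A B D : Coalgebra H} (m : B ⟶ D) [Mono (H.map m.f)] (f : A ⟶ D) (g : A.V ⟶ B.V)
    (w : g ≫ m.f = f.f) : A ⟶ B where
  f := g
  h := by
    rw [← cancel_mono (H.map m.f), Category.assoc, ← H.map_comp, w, f.h, Category.assoc, m.h,
      reassoc_of% w]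

/-- Transport of a coalgebra structure along an isomorphism. -/
def coalgebraOfIso (A : Coalgebra H) {X : C} (j : A.V ≅ X) : Coalgebra H where
  V := X
  str := j.inv ≫ A.str ≫ H.map j.hom

/-- A coalgebra is isomorphic to its transport. -/
def isoCoalgebraOfIso (A : Coalgebra H) {X : C} (j : A.V ≅ X) : A ≅ coalgebraOfIso A j :=
  Coalgebra.isoMk j (j.hom_inv_id_assoc _).symm

theorem isIso_of_mono_of_strongEpi_carrier {A B : Coalgebra H} (f : A ⟶ B) [Mono f.f]
    [StrongEpi f.f] : IsIso f := by
  have : IsIso f.f := isIso_of_mono_of_strongEpi f.f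
  exact Coalgebra.iso_of_iso f

theorem IsSimple.eq_of_hom [HasColimits C] {A B : Coalgebra H} (hB : IsSimple B) (f g : A ⟶ B) :
    f = g := by
  let c := coequalizer.π f.f g.f
  have hc : StrongEpi c :=
    strongEpi_of_isCoequalizer (coequalizer.condition _ _) (coequalizerIsCoequalizer _ _)
  have w : f.f ≫ B.str ≫ H.map c = g.f ≫ B.str ≫ H.map c := by
    rw [← f.h_assoc, ← g.h_assoc, ← H.map_comp, ← H.map_comp, coequalizer.condition]
  let Q : Coalgebra H := ⟨coequalizer f.f g.f, coequalizer.desc _ w⟩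
  let q : B ⟶ Q := { f := c, h := (coequalizer.π_desc _ w).symm }
  have := hB Q q hc
  rw [← cancel_mono q]
  exact Coalgebra.ext (coequalizer.condition _ _)

theorem exists_coalgebra_cocone [HasColimits C] {ι : Type v} (X : ι → Coalgebra H) :
    ∃ P : Coalgebra H, ∀ i, Nonempty (X i ⟶ P) :=
  ⟨⟨∐ fun i => (X i).V, Sigma.desc fun i => (X i).str ≫ H.map (Sigma.ι (fun i => (X i).V) i)⟩,
    fun i => ⟨{ f := Sigma.ι (fun i => (X i).V) i
                h := by simp }⟩⟩

/-- Subcoalgebras of simple coalgebras are simple. -/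
theorem IsSimple.of_mono [HasColimits C] {Q S : Coalgebra H} (hS : IsSimple S) (m : Q ⟶ S)
    [Mono m.f] : IsSimple Q := by
  intro Q' q hq
  -- Pushing `q` out along `m` gives a quotient of `S`, hence an isomorphism; then `q` is monic as
  -- well.
  let a := pushout.inl m.f q.f
  let b := pushout.inr m.f q.f
  have hab : m.f ≫ a = q.f ≫ b := pushout.condition
  have ha : StrongEpi a := ⟨inferInstance, fun _ _ _ _ => inferInstance⟩
  have w : m.f ≫ S.str ≫ H.map a = q.f ≫ Q'.str ≫ H.map b := by
    rw [← m.h_assoc, ← q.h_assoc, ← H.map_comp, ← H.map_comp, hab]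
  let P : Coalgebra H := ⟨pushout m.f q.f, pushout.desc _ _ w⟩
  let p : S ⟶ P := { f := a, h := (pushout.inl_desc _ _ w).symm }
  have := hS P p ha
  have : IsIso a := inferInstanceAs (IsIso ((Coalgebra.forget H).map p))
  have : Mono (q.f ≫ b) := by rw [← hab]; infer_instance
  have : Mono q.f := mono_of_mono q.f b
  exact isIso_of_mono_of_strongEpi_carrier q

variable [HasColimits C] [WellPowered.{v} Cᵒᵖ]

/-- The structure on the image is a diagonal fill-in, available because `H` preserves monomorphisms.
-/
theorem exists_hom_factorization (hH : PreservesIntersections H) {A B : Coalgebra H} (f : A ⟶ B) :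
    ∃ (I : Coalgebra H) (e : A ⟶ I) (m : I ⟶ B), StrongEpi e.f ∧ Mono m.f ∧ e ≫ m = f := by
  obtain ⟨I, e, m, he, hm, w⟩ := exists_strongEpi_mono_factorization f.f
  have := hH.map_mono m
  have sq : CommSq (A.str ≫ H.map e) e (H.map m) (m ≫ B.str) := ⟨by
    rw [Category.assoc, ← H.map_comp, w, reassoc_of% w, f.h]⟩
  exact ⟨⟨I, sq.lift⟩, { f := e, h := sq.fac_left.symm }, { f := m, h := sq.fac_right },
    he, hm, Coalgebra.ext w⟩

theorem IsSimple.mono_hom (hH : PreservesIntersections H) {A B : Coalgebra H} (hA : IsSimple A)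
    (f : A ⟶ B) : Mono f.f := by
  obtain ⟨I, e, m, he, hm, rfl⟩ := exists_hom_factorization hH f
  have := hA I e he
  have : IsIso e.f := inferInstanceAs (IsIso ((Coalgebra.forget H).map e))
  rw [Coalgebra.comp_f]
  infer_instance

/-- Every coalgebra has a simple quotient, which is its greatest quotient. -/
theorem exists_simple_quotient (A : Coalgebra H) :
    ∃ (S : Coalgebra H) (e : A ⟶ S), StrongEpi e.f ∧ IsSimple S ∧
      ∀ (B : Coalgebra H) (q : A ⟶ B), StrongEpi q.f → ∃ r : B ⟶ S, q ≫ r = e := by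
  obtain ⟨ι, X, e, he, hX⟩ := exists_small_quotients A.V
    (fun X (e : A.V ⟶ X) => StrongEpi e ∧ ∃ s, A.str ≫ H.map e = e ≫ s)
  choose s hs using fun i => (he i).2
  have : ∀ i, StrongEpi (e i) := fun i => (he i).1
  obtain ⟨W, w, k, hw, hk, hW⟩ := exists_cointersection X e
  obtain ⟨t, ht⟩ := hW (H.obj W) (A.str ≫ H.map w) (fun i => s i ≫ H.map (k i)) fun i => by
    rw [← Category.assoc, ← hs, Category.assoc, ← H.map_comp, hk]
  let S : Coalgebra H := ⟨W, t⟩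
  let p : A ⟶ S := { f := w, h := ht.symm }
  have huniv : ∀ (B : Coalgebra H) (q : A ⟶ B), StrongEpi q.f → ∃ r : B ⟶ S, q ≫ r = p := by
    intro B q hq
    obtain ⟨i, j, hj⟩ := hX q.f ⟨hq, B.str, q.h⟩
    have hr : q.f ≫ j.inv ≫ k i = p.f := by
      rw [← hj]
      simp [hk, p]
    exact ⟨homOfEpi q p _ hr, Coalgebra.ext hr⟩
  -- A quotient of `S` is again a quotient of `A`, so it maps back to `S`, making `q` a split
  -- monomorphism.
  refine ⟨S, p, hw, fun B q hq => ?_, huniv⟩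
  have hw' : StrongEpi p.f := hw
  obtain ⟨r, hr⟩ := huniv B (p ≫ q) (by rw [Coalgebra.comp_f]; infer_instance)
  have h1 : q.f ≫ r.f = 𝟙 _ := by
    rw [← cancel_epi p.f, Category.comp_id]
    simpa using congrArg Coalgebra.Hom.f hr
  have : Mono (q.f ≫ r.f) := by rw [h1]; infer_instance
  have : Mono q.f := mono_of_mono q.f r.f
  exact isIso_of_mono_of_strongEpi_carrier q

end Coalgebras

/-! ### Least subcoalgebras and well-pointed modifications -/

section Pointed

variable {C : Type u} [Category.{v} C] {H : C ⥤ C} {U : C ⥤ Type v}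

theorem PreservesIntersections.injective (hU : PreservesIntersections U) {A B : C} (m : A ⟶ B)
    [Mono m] : Function.Injective (U.map m) :=
  have := hU.map_mono m
  (mono_iff_injective _).1 this

/-- A homomorphism which preserves points, as a morphism of pointed coalgebras. -/
abbrev pointedHom {P Q : PointedCoalgebra H U} (f : P.1 ⟶ Q.1) (h : U.map f.f P.2 = Q.2) :
    P ⟶ Q :=
  CategoryOfElements.homMk P Q f h

theorem map_carrier_point {P Q : PointedCoalgebra H U} (f : P ⟶ Q) :
    U.map (PointedCoalgebra.carrier f) P.2 = Q.2 := f.2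

theorem isIso_pointed_iff {P Q : PointedCoalgebra H U} (f : P ⟶ Q) : IsIso f ↔ IsIso f.1 := by
  refine ⟨fun _ => inferInstanceAs (IsIso ((CategoryOfElements.π _).map f)), fun h => ?_⟩
  have : IsIso ((CategoryOfElements.π _).map f) := h
  exact isIso_of_reflects_iso f (CategoryOfElements.π _)

theorem isIso_carrier {P Q : PointedCoalgebra H U} (f : P ⟶ Q) [IsIso f] :
    IsIso (PointedCoalgebra.carrier f) :=
  have := (isIso_pointed_iff f).1 inferInstance
  inferInstanceAs (IsIso ((Coalgebra.forget H).map f.1))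

theorem IsWellPointed.isSimple {P : PointedCoalgebra H U} (hP : IsWellPointed P) :
    IsSimple P.1 := fun B q hq =>
  (isIso_pointed_iff _).1 (hP.1 (PointedCoalgebra.mk B (U.map q.f P.2)) (pointedHom q rfl) hq)

/-- Factorization of a morphism of pointed coalgebras through a subcoalgebra. -/
theorem exists_pointed_lift (hH : PreservesIntersections H) (hU : PreservesIntersections U)
    {P Q S : PointedCoalgebra H U} (m : Q ⟶ S) [Mono (PointedCoalgebra.carrier m)] (f : P ⟶ S)
    (g : P.1.V ⟶ Q.1.V)
    (w : g ≫ PointedCoalgebra.carrier m = PointedCoalgebra.carrier f) :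
    ∃ k : P ⟶ Q, k ≫ m = f := by
  have := hH.map_mono (PointedCoalgebra.carrier m)
  refine ⟨pointedHom (homOfMono m.1 f.1 g w) ?_, ?_⟩
  · apply hU.injective (PointedCoalgebra.carrier m)
    refine Eq.trans ?_ ((map_carrier_point f).trans (map_carrier_point m).symm)
    rw [← w, U.map_comp]
    rfl
  · exact CategoryOfElements.ext _ _ _ (Coalgebra.ext w)

theorem IsLeastSubcoalgebra.nonempty_iso {P Q S : PointedCoalgebra H U} {m : P ⟶ S} {n : Q ⟶ S}
    (hm : IsLeastSubcoalgebra m) (hn : IsLeastSubcoalgebra n) : Nonempty (P ≅ Q) := by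
  obtain ⟨k, hk⟩ := hm.2 Q n hn.1
  obtain ⟨l, hl⟩ := hn.2 P m hm.1
  have hm' : Mono m := ⟨fun g h e => CategoryOfElements.ext _ _ _ (Coalgebra.ext
    (hm.1.1 _ _ (congrArg PointedCoalgebra.carrier e)))⟩
  have hn' : Mono n := ⟨fun g h e => CategoryOfElements.ext _ _ _ (Coalgebra.ext
    (hn.1.1 _ _ (congrArg PointedCoalgebra.carrier e)))⟩
  exact ⟨⟨k, l, by rw [← cancel_mono m]; simp [hk, hl], by rw [← cancel_mono n]; simp [hk, hl]⟩⟩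

theorem IsLeastSubcoalgebra.iso_comp {P Q S : PointedCoalgebra H U} {m : Q ⟶ S}
    (hm : IsLeastSubcoalgebra m) (i : P ≅ Q) : IsLeastSubcoalgebra (i.hom ≫ m) := by
  have := hm.1
  have := isIso_carrier i.hom
  refine ⟨inferInstanceAs
    (Mono (PointedCoalgebra.carrier i.hom ≫ PointedCoalgebra.carrier m)), fun Q' m' hm' => ?_⟩
  obtain ⟨k, hk⟩ := hm.2 Q' m' hm'
  exact ⟨i.hom ≫ k, by rw [Category.assoc, hk]⟩

theorem IsLeastSubcoalgebra.isWellPointed [HasColimits C] {Q S : PointedCoalgebra H U} {m : Q ⟶ S}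
    (hm : IsLeastSubcoalgebra m) (hS : IsSimple S.1) : IsWellPointed Q := by
  have hm1 := hm.1
  have hQ : IsSimple Q.1 := hS.of_mono m.1
  refine ⟨fun R q hq => (isIso_pointed_iff q).2 (hQ R.1 q.1 hq), fun R n hn => ?_⟩
  have : Mono (PointedCoalgebra.carrier (n ≫ m)) :=
    inferInstanceAs (Mono (PointedCoalgebra.carrier n ≫ PointedCoalgebra.carrier m))
  obtain ⟨k, hk⟩ := hm.2 R (n ≫ m) this
  have h1 : PointedCoalgebra.carrier k ≫ PointedCoalgebra.carrier n = 𝟙 _ := by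
    rw [← cancel_mono (PointedCoalgebra.carrier m), Category.assoc, Category.id_comp]
    exact congrArg PointedCoalgebra.carrier hk
  have : IsIso (PointedCoalgebra.carrier n) :=
    ⟨PointedCoalgebra.carrier k, by
      rw [← cancel_mono (PointedCoalgebra.carrier n), Category.assoc, h1]; simp, h1⟩
  exact (isIso_pointed_iff n).2 (Coalgebra.iso_of_iso n.1)

variable [HasColimits C] [WellPowered.{v} Cᵒᵖ]

/-- Every pointed coalgebra has a least subcoalgebra containing the point. -/
theorem exists_isLeastSubcoalgebra [WellPowered.{v} C] (hH : PreservesIntersections H)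
    (hU : PreservesIntersections U) (S : PointedCoalgebra H U) :
    ∃ (Q : PointedCoalgebra H U) (m : Q ⟶ S), IsLeastSubcoalgebra m := by
  obtain ⟨ι, X, m, hm, hX⟩ := exists_small_subobjects S.1.V
    (fun X (m : X ⟶ S.1.V) => (∃ s, s ≫ H.map m = m ≫ S.1.str) ∧ ∃ x, U.map m x = S.2)
  choose s hs using fun i => (hm i).1.1
  choose x hx using fun i => (hm i).1.2
  have hm' : ∀ i, Mono (m i) := fun i => (hm i).2
  obtain ⟨W, w, k, hw, hk, hW⟩ := exists_intersection X m
  obtain ⟨t, ht, -⟩ := hH.exists_lift X m hm' w k hk hW (w ≫ S.1.str) (fun i => k i ≫ s i)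
    fun i => by rw [Category.assoc, hs, reassoc_of% hk i]
  -- Elements are maps from `PUnit`, so preservation by `U` puts the point in the intersection.
  obtain ⟨y, hy, -⟩ := hU.exists_lift X m hm' w k hk hW (Z := PUnit) (↾fun _ => S.2)
    (fun i => ↾fun _ => x i) fun i => by
      ext
      exact hx i
  let f : PointedCoalgebra.mk (U := U) (⟨W, t⟩ : Coalgebra H) (y PUnit.unit) ⟶ S :=
    pointedHom { f := w, h := ht } (ConcreteCategory.congr_hom hy PUnit.unit)
  refine ⟨_, f, hw, fun Q' m' _ => ?_⟩
  obtain ⟨i, j, hj⟩ := hX (PointedCoalgebra.carrier m')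
    ⟨⟨Q'.1.str, m'.1.h⟩, Q'.2, map_carrier_point m'⟩
  refine exists_pointed_lift hH hU m' f (k i ≫ j.inv) ?_
  rw [← hj, Category.assoc, Iso.inv_hom_id_assoc, hk]
  rfl

/-- Well-pointed coalgebras are least subcoalgebras of all coalgebras to which they are mapped. -/
theorem IsWellPointed.isLeastSubcoalgebra [WellPowered.{v} C] (hH : PreservesIntersections H)
    (hU : PreservesIntersections U) {P S : PointedCoalgebra H U} (hP : IsWellPointed P)
    (m : P ⟶ S) : IsLeastSubcoalgebra m := by
  have hm : Mono (PointedCoalgebra.carrier m) := hP.isSimple.mono_hom hH m.1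
  refine ⟨hm, fun Q' m' hm' => ?_⟩
  obtain ⟨L, l, hl⟩ := exists_isLeastSubcoalgebra hH hU S
  obtain ⟨k, hk⟩ := hl.2 P m hm
  have : Mono (PointedCoalgebra.carrier k ≫ PointedCoalgebra.carrier m) := by
    have : PointedCoalgebra.carrier k ≫ PointedCoalgebra.carrier m = PointedCoalgebra.carrier l :=
      congrArg PointedCoalgebra.carrier hk
    rw [this]
    exact hl.1
  have := hP.2 L k (mono_of_mono _ (PointedCoalgebra.carrier m))
  obtain ⟨k', hk'⟩ := hl.2 Q' m' hm'
  exact ⟨inv k ≫ k', by rw [Category.assoc, hk', ← hk, IsIso.inv_hom_id_assoc]⟩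

/-- If `P` is mapped to a simple pointed coalgebra `R`, then the well-pointed modification of `P`
is the well-pointed coalgebra mapped to `R`. -/
theorem isWellPointedModification_iff [WellPowered.{v} C] (hH : PreservesIntersections H)
    (hU : PreservesIntersections U) {P R Q₀ : PointedCoalgebra H U} (f : P ⟶ R)
    (hR : IsSimple R.1) (hQ₀ : IsWellPointed Q₀) (m₀ : Q₀ ⟶ R) (Q : PointedCoalgebra H U) :
    IsWellPointedModification P Q ↔ Nonempty (Q ≅ Q₀) := by
  obtain ⟨I, e, m, he, hm, hem⟩ := exists_hom_factorization hH f.1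
  have hI : IsSimple I := hR.of_mono m
  let S : PointedCoalgebra H U := PointedCoalgebra.mk I (U.map e.f P.2)
  let m' : S ⟶ R := pointedHom m (by
    rw [← map_carrier_point f]
    change U.map m.f (U.map e.f P.2) = U.map f.1.f P.2
    rw [← hem, Coalgebra.comp_f, U.map_comp]
    rfl)
  have hl₀ := hQ₀.isLeastSubcoalgebra hH hU m₀
  constructor
  · rintro ⟨S', e', n, ⟨he', hS'⟩, hn⟩
    -- The arbitrary simple quotient `S'` is compared with the image `I` through the greatest
    -- quotient `S₀`, to which `I` is isomorphic.
    obtain ⟨S₀, e₀, he₀, hS₀, huniv⟩ := exists_simple_quotient P.1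
    obtain ⟨r', hr'⟩ := huniv S'.1 e'.1 he'
    obtain ⟨r, hr⟩ := huniv I e he
    have hr1 : StrongEpi r.f := by
      have : e.f ≫ r.f = e₀.f := congrArg Coalgebra.Hom.f hr
      have : StrongEpi (e.f ≫ r.f) := by rw [this]; exact he₀
      exact strongEpi_of_strongEpi e.f r.f
    have := hI S₀ r hr1
    have hfac : e'.1 ≫ r' ≫ inv r ≫ m = f.1 := by
      rw [← Category.assoc, hr', ← hr, Category.assoc, IsIso.hom_inv_id_assoc, hem]
    let g : S' ⟶ R := pointedHom (r' ≫ inv r ≫ m) (by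
      rw [← map_carrier_point f, ← map_carrier_point e']
      have := congrArg (fun h => U.map (Coalgebra.Hom.f h) P.2) hfac
      rw [Coalgebra.comp_f, U.map_comp] at this
      exact this)
    exact ((hn.isWellPointed hS').isLeastSubcoalgebra hH hU (n ≫ g)).nonempty_iso hl₀
  · rintro ⟨i⟩
    obtain ⟨L, l, hl⟩ := exists_isLeastSubcoalgebra hH hU S
    have hL := hl.isWellPointed hI
    obtain ⟨j⟩ := (hL.isLeastSubcoalgebra hH hU (l ≫ m')).nonempty_iso hl₀
    refine ⟨S, pointedHom e rfl, (i ≪≫ j.symm).hom ≫ l, ⟨he, hI⟩, hl.iso_comp _⟩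

end Pointed

/-! ### Size bounds and construction of the final coalgebra -/

section Final

variable {C : Type u} [Category.{v} C] {H : C ⥤ C} {U : C ⥤ Type v}

/-- If the underlying sets of all simple coalgebras can be embedded into one set, then the simple
coalgebras are essentially small. -/
theorem exists_small_simple (hUsmall : FibreSmall U) (hUtrans : UniquelyTransportable U)
    {T : Type v} (hT : ∀ A : Coalgebra H, IsSimple A →
      ∃ f : U.obj A.V → T, Function.Injective f) :
    ∃ (ι : Type v) (Y : ι → Coalgebra H), ∀ A, IsSimple A → ∃ i, Nonempty (A ≅ Y i) := by
  choose Q hQ hle using fun X : Set T => (hUsmall X).exists_small_le'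
  let obj : ∀ X : Set T, Shrink.{v} (Subtype (Q X)) → C := fun X a =>
    have := hQ X
    ((equivShrink _).symm a).1
  -- An index consists of a subset of `T`, a representative object over it, and a structure map.
  refine ⟨Σ (X : Set T) (a : Shrink.{v} (Subtype (Q X))), (obj X a ⟶ H.obj (obj X a)),
    fun i => ⟨obj i.1 i.2.1, i.2.2⟩, fun A hA => ?_⟩
  obtain ⟨f, hf⟩ := hT A hA
  obtain ⟨B, ⟨hB, i, -⟩, -⟩ := hUtrans A.V (Set.range f) (Equiv.ofInjective f hf)
  obtain ⟨D, hD, ⟨j⟩⟩ := hle (Set.range f) B hB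
  let a : Shrink.{v} (Subtype (Q (Set.range f))) := equivShrink _ ⟨D, hD⟩
  have ha : D = obj (Set.range f) a := by simp [obj, a]
  let k : A.V ≅ obj (Set.range f) a := i ≪≫ j ≪≫ eqToIso ha
  exact ⟨⟨Set.range f, a, (coalgebraOfIso A k).str⟩, ⟨isoCoalgebraOfIso A k⟩⟩

/-- Essential smallness yields a set of representatives. -/
theorem exists_representsWellPointed
    (h : ObjectProperty.EssentiallySmall.{v} (fun P : PointedCoalgebra H U => IsWellPointed P)) :
    ∃ (T : Type v) (rep : T → PointedCoalgebra H U), RepresentsWellPointed rep := by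
  obtain ⟨Q, hQ, hQle, hle⟩ := h.exists_small_le
  let obj : Shrink.{v} (Subtype Q) → PointedCoalgebra H U := fun a => ((equivShrink _).symm a).1
  let r : Setoid (Shrink.{v} (Subtype Q)) :=
    ⟨fun a b => Nonempty (obj a ≅ obj b), fun a => ⟨Iso.refl _⟩, fun ⟨i⟩ => ⟨i.symm⟩,
      fun ⟨i⟩ ⟨j⟩ => ⟨i ≪≫ j⟩⟩
  refine ⟨Quotient r, fun t => obj t.out, fun t => hQle _ ((equivShrink _).symm t.out).2,
    fun P hP => ?_⟩
  obtain ⟨P', hP', ⟨i⟩⟩ := hle P hP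
  let a := equivShrink (Subtype Q) ⟨P', hP'⟩
  have ha : P' = obj a := by simp [obj, a]
  obtain ⟨j⟩ : Nonempty (obj (Quotient.mk r a).out ≅ obj a) := Quotient.mk_out a
  refine ⟨Quotient.mk r a, ⟨i ≪≫ eqToIso ha ≪≫ j.symm⟩, fun t ⟨k⟩ => ?_⟩
  rw [← Quotient.out_eq t]
  exact Quotient.sound ⟨k.symm ≪≫ i ≪≫ eqToIso ha⟩

/-- A small set of simple coalgebras yields a simple weakly terminal coalgebra. -/
theorem exists_simple_weakly_terminal [HasColimits C] [WellPowered.{v} Cᵒᵖ]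
    {ι : Type v} (Y : ι → Coalgebra H) (hY : ∀ A, IsSimple A → ∃ i, Nonempty (A ≅ Y i)) :
    ∃ N : Coalgebra H, IsSimple N ∧ ∀ A : Coalgebra H, Nonempty (A ⟶ N) := by
  obtain ⟨P, hP⟩ := exists_coalgebra_cocone Y
  obtain ⟨N, q, -, hN, -⟩ := exists_simple_quotient P
  refine ⟨N, hN, fun A => ?_⟩
  obtain ⟨S, e, -, hS, -⟩ := exists_simple_quotient A
  obtain ⟨i, ⟨j⟩⟩ := hY S hS
  obtain ⟨k⟩ := hP i
  exact ⟨e ≫ j.hom ≫ k ≫ q⟩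

theorem eq_of_pointed_hom [HasColimits C] {A : Coalgebra H} (hA : IsSimple A) {x y : U.obj A.V}
    {P : PointedCoalgebra H U} (f : P ⟶ PointedCoalgebra.mk A x)
    (g : P ⟶ PointedCoalgebra.mk A y) : x = y := by
  have hfg : f.1 = g.1 := hA.eq_of_hom f.1 g.1
  refine (map_carrier_point f).symm.trans (Eq.trans ?_ (map_carrier_point g))
  rw [PointedCoalgebra.carrier, hfg]

variable [HasColimits C] [WellPowered.{v} C] [WellPowered.{v} Cᵒᵖ]

theorem RepresentsWellPointed.exists_hom (hH : PreservesIntersections H)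
    (hU : PreservesIntersections U) {T : Type v} {rep : T → PointedCoalgebra H U}
    (hrep : RepresentsWellPointed rep) {P : PointedCoalgebra H U} (hP : IsSimple P.1) :
    ∃ t, Nonempty (rep t ⟶ P) := by
  obtain ⟨Q, m, hm⟩ := exists_isLeastSubcoalgebra hH hU P
  obtain ⟨t, ⟨i⟩, -⟩ := hrep.2 Q (hm.isWellPointed hP)
  exact ⟨t, ⟨i.inv ≫ m⟩⟩

/-- Both representatives are least subcoalgebras of `P` at its point, hence isomorphic. -/
theorem RepresentsWellPointed.eq_of_hom (hH : PreservesIntersections H)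
    (hU : PreservesIntersections U) {T : Type v} {rep : T → PointedCoalgebra H U}
    (hrep : RepresentsWellPointed rep) {P : PointedCoalgebra H U} {s t : T}
    (f : rep s ⟶ P) (g : rep t ⟶ P) : s = t :=
  (hrep.2 (rep s) (hrep.1 s)).unique ⟨Iso.refl _⟩
    (((hrep.1 s).isLeastSubcoalgebra hH hU f).nonempty_iso
      ((hrep.1 t).isLeastSubcoalgebra hH hU g))

/-- A set of representatives of the well-pointed coalgebras is in bijection with the underlying
set of a simple weakly terminal coalgebra. -/
theorem RepresentsWellPointed.exists_final (hH : PreservesIntersections H)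
    (hU : PreservesIntersections U) (hUsmall : FibreSmall U) (hUtrans : UniquelyTransportable U)
    {T : Type v} {rep : T → PointedCoalgebra H U} (hrep : RepresentsWellPointed rep) :
    ∃ (N : Coalgebra H) (φ : U.obj N.V ≃ T), IsSimple N ∧ (∀ A : Coalgebra H, Nonempty (A ⟶ N)) ∧
      ∀ y, Nonempty (rep (φ y) ⟶ PointedCoalgebra.mk N y) := by
  have key : ∀ A : Coalgebra H, IsSimple A → ∃ f : U.obj A.V → T, Function.Injective f ∧
      ∀ y, Nonempty (rep (f y) ⟶ PointedCoalgebra.mk A y) := by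
    intro A hA
    choose f hf using fun y : U.obj A.V =>
      hrep.exists_hom hH hU (P := PointedCoalgebra.mk A y) hA
    refine ⟨f, fun x y hxy => ?_, hf⟩
    obtain ⟨g⟩ := hf x
    obtain ⟨h⟩ := hf y
    rw [← hxy] at h
    exact eq_of_pointed_hom hA g h
  obtain ⟨ι, Y, hY⟩ := exists_small_simple hUsmall hUtrans (H := H) (T := T)
    fun A hA => (key A hA).imp fun _ h => h.1
  obtain ⟨N, hN, hterm⟩ := exists_simple_weakly_terminal Y hY
  obtain ⟨f, hf, hfrep⟩ := key N hN
  refine ⟨N, Equiv.ofBijective f ⟨hf, fun t => ?_⟩, hN, hterm, hfrep⟩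
  -- Surjectivity: the image in `N` of the point of `rep t` is a preimage of `t`.
  obtain ⟨g⟩ := hterm (rep t).1
  obtain ⟨h⟩ := hfrep (U.map g.f (rep t).2)
  exact ⟨U.map g.f (rep t).2, hrep.eq_of_hom hH hU h (pointedHom g rfl)⟩

/-- Well-pointed coalgebras are subcoalgebras of the final coalgebra. -/
theorem essentiallySmall_isWellPointed [HasTerminal (Coalgebra H)]
    (hH : PreservesIntersections H) :
    ObjectProperty.EssentiallySmall.{v} (fun P : PointedCoalgebra H U => IsWellPointed P) := by
  obtain ⟨ι, X, m, -, hX⟩ := exists_small_subobjects (⊤_ (Coalgebra H)).V (fun _ _ => True)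
  let F : (Σ i : ι, (X i ⟶ H.obj (X i)) × U.obj (X i)) → PointedCoalgebra H U :=
    fun a => PointedCoalgebra.mk ⟨X a.1, a.2.1⟩ a.2.2
  refine ⟨ObjectProperty.ofObj F, inferInstance, fun P hP => ?_⟩
  have : Mono (terminal.from P.1).f := hP.isSimple.mono_hom hH _
  obtain ⟨i, j, -⟩ := hX (terminal.from P.1).f trivial
  exact ⟨_, ObjectProperty.ofObj_apply F ⟨i, (coalgebraOfIso P.1 j).str, U.map j.hom P.2⟩,
    ⟨CategoryOfElements.isoMk _ _ (isoCoalgebraOfIso P.1 j) rfl⟩⟩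

end Final

end WellPointed

/-! ### The main theorem -/

open WellPointed

theorem mainTheorem3 {C : Type u} [Category.{v} C]
    [HasColimits C] [WellPowered.{v} C] [WellPowered.{v} Cᵒᵖ]
    (U : C ⥤ Type v) [U.Faithful]
    (hUint : PreservesIntersections U) (hUsmall : FibreSmall U)
    (hUtrans : UniquelyTransportable U)
    (H : C ⥤ C) (hH : PreservesIntersections H) :
    (HasTerminal (Coalgebra H) ↔
        ObjectProperty.EssentiallySmall.{v}
          (fun P : PointedCoalgebra H U => IsWellPointed P)) ∧
      ∀ (T : Type v) (rep : T → PointedCoalgebra H U), RepresentsWellPointed rep →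
        ∃ aPlus : ∀ A : Coalgebra H, U.obj A.V → T,
          (∀ (A : Coalgebra H) (x : U.obj A.V) (Q : PointedCoalgebra H U),
            IsWellPointedModification (PointedCoalgebra.mk A x) Q ↔
              Nonempty (Q ≅ rep (aPlus A x))) ∧
          ∃ (N : Coalgebra H) (hN : U.obj N.V = T),
            Nonempty (IsTerminal N) ∧
            ∀ A : Coalgebra H, ∃ f : A ⟶ N,
              (∀ x : U.obj A.V, cast hN (U.map f.f x) = aPlus A x) ∧
              ∀ g : A ⟶ N, g = f := by
  refine ⟨⟨fun _ => essentiallySmall_isWellPointed hH, fun h => ?_⟩, fun T rep hrep => ?_⟩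
  · obtain ⟨T, rep, hrep⟩ := exists_representsWellPointed h
    obtain ⟨N, -, hN, hterm, -⟩ := hrep.exists_final hH hUint hUsmall hUtrans
    exact (IsTerminal.ofUniqueHom (fun A => (hterm A).some) fun A g => hN.eq_of_hom g _).hasTerminal
  · obtain ⟨N, φ, hN, hterm, hφ⟩ := hrep.exists_final hH hUint hUsmall hUtrans
    let f := fun A => (hterm A).some
    -- Transport along `φ` makes the underlying set equal to `T` itself.
    obtain ⟨B, ⟨hB, i, hi⟩, -⟩ := hUtrans N.V T φ
    let j := isoCoalgebraOfIso N i
    have huniq : ∀ (A : Coalgebra H) (g : A ⟶ coalgebraOfIso N i), g = f A ≫ j.hom :=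
      fun A g => by rw [← cancel_mono j.inv]; exact hN.eq_of_hom _ _
    refine ⟨fun A x => φ (U.map (f A).f x), fun A x Q => ?_, coalgebraOfIso N i, hB,
      ⟨IsTerminal.ofUniqueHom (fun A => f A ≫ j.hom) huniq⟩,
      fun A => ⟨f A ≫ j.hom, fun x => ?_, huniq A⟩⟩
    · exact isWellPointedModification_iff hH hUint
        (R := PointedCoalgebra.mk N (U.map (f A).f x)) (pointedHom (f A) rfl) hN (hrep.1 _)
        (hφ _).some Q
    · refine Eq.trans ?_ (hi (U.map (f A).f x))
      rw [Coalgebra.comp_f, U.map_comp]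
      rfl
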